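/- Let $\alpha\in(0,1)$ be irrational. For a finite (simple) graph $A$ put $\delta_\alpha(A)=|A|-\alpha\cdot|\mathrm{edges}(A)|$. Substructures are induced subgraphs. Let $\mathbf K_\alpha$ be the class of finite graphs $A$ such that $\delta_\alpha(A')\ge 0$ for every $A'\subseteq A$. For finite graphs $A\subseteq B$ write $A\leqslant_\alpha B$ if $\delta_\alpha(C)-\delta_\alpha(A)\ge 0$ for every $C$ with $A\subseteq C\subseteq B$; for a finite $A\subseteq M$ in an arbitrary graph $M$ write $A\leqslant_\alpha M$ if $A\leqslant_\alpha B$ for every finite $B$ with $A\subseteq B\subseteq M$. A countable graph $M$ is called $(\mathbf K_\alpha,\leqslant_\alpha)$-generic if 1. up to isomorphism, the finite induced subgraphs of $M$ are exactly the members of $\mathbf K_\alpha$; 2. $M=\bigcup_{i\in\omega}A_i$ for some increasing chain of finite sets with $A_i\leqslant_\alpha M$; 3. if $A\leqslant_\alpha M$ and $A\leqslant_\alpha B\in\mathbf K_\alpha$, there is an embedding $\Lambda:B\to M$ that is the identity on $A$ and satisfies $\Lambda[B]\leqslant_\alpha M$. A topological group $G$ is amenable if every continuous action of $G$ on a nonempty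 compact Hausdorff space admits an invariant Borel probability measure. Then a $(\mathbf K_\alpha,\leqslant_\alpha)$-generic graph $\mathbf M^\alpha$ exists, and for every such graph the group $\mathrm{Aut}(\mathbf M^\alpha)$, with the topology of pointwise convergence, is not amenable. -/

import Mathlib

open MeasureTheory

universe u

/-- A topological group `G` is amenable if every continuous action of `G` on a nonempty compact
Hausdorff space (a `G`-flow) admits an invariant Borel probability measure. -/
def IsAmenableGroup (G : Type u) [Group G] [TopologicalSpace G] [IsTopologicalGroup G] : Prop :=
  ∀ (X : Type u) [TopologicalSpace X] [CompactSpace X] [T2Space X] [Nonempty X]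
    [MeasurableSpace X] [BorelSpace X] [MulAction G X] [ContinuousSMul G X],
    ∃ μ : Measure X, IsProbabilityMeasure μ ∧ ∀ g : G, μ.map (fun x => g • x) = μ

namespace SimpleGraph

variable {V : Type u}

/-- The topology of pointwise convergence on the automorphism group of a graph: the topology
induced from the product topology on `V → V`, where `V` is discrete. -/
instance autTopology (M : SimpleGraph V) : TopologicalSpace (M ≃g M) :=
  TopologicalSpace.induced (fun (g : M ≃g M) (v : V) => g v)
    (@Pi.topologicalSpace V (fun _ => V) (fun _ => ⊥))

/-- The evaluation sets `{g | g v = w}` are open. -/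
theorem isOpen_aut_eval (M : SimpleGraph V) (v w : V) : IsOpen {g : M ≃g M | g v = w} := by
  let _ : TopologicalSpace V := ⊥
  have _ : DiscreteTopology V := ⟨rfl⟩
  have h : Continuous (fun (g : M ≃g M) (v : V) => g v) := continuous_induced_dom
  exact (isOpen_discrete ({w} : Set V)).preimage ((continuous_apply v).comp h)

theorem continuous_to_aut {Y : Type*} [TopologicalSpace Y] (M : SimpleGraph V) (F : Y → (M ≃g M))
    (hF : ∀ v w, IsOpen {y | F y v = w}) : Continuous F := by
  let _ : TopologicalSpace V := ⊥
  have _ : DiscreteTopology V := ⟨rfl⟩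
  refine continuous_induced_rng.2 (continuous_pi fun v => ?_)
  exact continuous_discrete_rng.2 fun w => hF v w

instance autIsTopologicalGroup (M : SimpleGraph V) : IsTopologicalGroup (M ≃g M) where
  continuous_mul := by
    refine continuous_to_aut M _ fun v w => ?_
    have : {p : (M ≃g M) × (M ≃g M) | (p.1 * p.2) v = w}
        = ⋃ u : V, {g : M ≃g M | g u = w} ×ˢ {h : M ≃g M | h v = u} := by
      ext p
      simp [RelIso.mul_apply]
    rw [this]
    exact isOpen_iUnion fun u => (isOpen_aut_eval M u w).prod (isOpen_aut_eval M v u)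
  continuous_inv := by
    refine continuous_to_aut M _ fun v w => ?_
    have : {g : M ≃g M | g⁻¹ v = w} = {g : M ≃g M | g w = v} := by
      ext g
      constructor
      · rintro rfl
        exact RelIso.apply_inv_self g v
      · rintro rfl
        exact RelIso.inv_apply_self g w
    rw [this]
    exact isOpen_aut_eval M w v

/-- The pre-dimension `δ_α(A) = |A| - α · |edges(A)|` of (the subgraph of `M` induced on) a finite
set `A` of vertices. It is only used for finite sets. -/
noncomputable def preDim (α : ℝ) (M : SimpleGraph V) (A : Set V) : ℝ :=
  (A.ncard : ℝ) - α * ((M.induce A).edgeSet.ncard : ℝ)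

/-- The class `K_α` of finite graphs all of whose induced subgraphs have nonnegative
pre-dimension. -/
def InClass (α : ℝ) (H : SimpleGraph V) : Prop :=
  Finite V ∧ ∀ A : Set V, 0 ≤ preDim α H A

/-- `A ≤_α B` for finite sets of vertices `A ⊆ B` of `M` (with the induced graph structure):
`δ_α(C) - δ_α(A) ≥ 0` for every `C` with `A ⊆ C ⊆ B`. -/
def IsStrongIn (α : ℝ) (M : SimpleGraph V) (A B : Set V) : Prop :=
  A ⊆ B ∧ ∀ C : Set V, A ⊆ C → C ⊆ B → 0 ≤ preDim α M C - preDim α M A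

/-- `A ≤_α M`: the set `A` is finite and `A ≤_α B` for every finite set `B ⊇ A` of vertices. -/
def IsStrong (α : ℝ) (M : SimpleGraph V) (A : Set V) : Prop :=
  A.Finite ∧ ∀ B : Set V, B.Finite → A ⊆ B → IsStrongIn α M A B

/-- `M` is a `(K_α, ≤_α)`-generic graph (Fraïssé–Hrushovski). -/
structure IsGeneric (α : ℝ) (M : SimpleGraph V) : Prop where
  /-- `M` is countable. -/
  countable : Countable V
  /-- `Age(M) ⊆ K_α`. -/
  age_subset : ∀ A : Set V, A.Finite → InClass α (M.induce A)
  /-- `K_α ⊆ Age(M)`. -/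
  subset_age : ∀ (W : Type) (H : SimpleGraph W), InClass α H → Nonempty (H ↪g M)
  /-- `M` is the union of a chain of closed finite sets. -/
  exists_chain : ∃ A : ℕ → Set V, Monotone A ∧ (∀ i, IsStrong α M (A i)) ∧ ⋃ i, A i = Set.univ
  /-- If `A ≤_α B ∈ K_α`, then every closed embedding of `A` in `M` extends to a closed embedding
  of `B` in `M`. -/
  extension : ∀ (W : Type) (H : SimpleGraph W), InClass α H →
    ∀ A : Set W, IsStrongIn α H A Set.univ →
    ∀ f : H.induce A ↪g M, IsStrong α M (Set.range f) →
    ∃ Λ : H ↪g M, (∀ a : A, Λ a = f a) ∧ IsStrong α M (Set.range Λ)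

end SimpleGraph

namespace SimpleGraph

/-! ### Calculus of the pre-dimension and of strong subsets. -/

section PreDim

variable {V W : Type*} {α : ℝ} {M : SimpleGraph V} {H : SimpleGraph W}

/-- `f` restricts to an isomorphism of `H.induce A` with an induced subgraph of `M`. -/
def IsEmbOn (H : SimpleGraph W) (M : SimpleGraph V) (f : W → V) (A : Set W) : Prop :=
  Set.InjOn f A ∧ ∀ x ∈ A, ∀ y ∈ A, M.Adj (f x) (f y) ↔ H.Adj x y

theorem IsEmbOn.mono {f : W → V} {A B : Set W} (h : IsEmbOn H M f B) (hAB : A ⊆ B) :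
    IsEmbOn H M f A :=
  ⟨h.1.mono hAB, fun x hx y hy => h.2 x (hAB hx) y (hAB hy)⟩

theorem IsEmbOn.comp {U : Type*} {K : SimpleGraph U} {g : U → W} {f : W → V} {A : Set U}
    (hf : IsEmbOn H M f (g '' A)) (hg : IsEmbOn K H g A) : IsEmbOn K M (f ∘ g) A :=
  ⟨hf.1.comp hg.1 (Set.mapsTo_image g A), fun x hx y hy =>
    (hf.2 _ (Set.mem_image_of_mem g hx) _ (Set.mem_image_of_mem g hy)).trans (hg.2 x hx y hy)⟩

theorem Embedding.isEmbOn (f : H ↪g M) (A : Set W) : IsEmbOn H M f A :=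
  ⟨f.injective.injOn, fun _ _ _ _ => f.map_adj_iff⟩

theorem isEmbOn_id {G M : SimpleGraph V} {A : Set V}
    (h : ∀ x ∈ A, ∀ y ∈ A, M.Adj x y ↔ G.Adj x y) : IsEmbOn G M id A :=
  ⟨Set.injOn_id A, h⟩

theorem isEmbOn_val (M : SimpleGraph V) (S : Set V) (A : Set S) :
    IsEmbOn (M.induce S) M Subtype.val A :=
  ⟨Subtype.val_injective.injOn, fun _ _ _ _ => Iff.rfl⟩

/-- The embedding of `H.induce A` given by a map which is an embedding on `A`. -/
def IsEmbOn.toEmbedding {f : W → V} {A : Set W} (h : IsEmbOn H M f A) : H.induce A ↪g M where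
  toFun x := f x
  inj' x y hxy := Subtype.ext (h.1 x.2 y.2 hxy)
  map_rel_iff' {x y} := h.2 x x.2 y y.2

theorem IsEmbOn.range_toEmbedding {f : W → V} {A : Set W} (h : IsEmbOn H M f A) :
    Set.range h.toEmbedding = f '' A := by
  rw [Set.image_eq_range]
  rfl

theorem preDim_image {f : W → V} {A : Set W} (h : IsEmbOn H M f A) :
    preDim α M (f '' A) = preDim α H A := by
  let e : H.induce A ≃g M.induce (f '' A) :=
    ⟨Equiv.Set.imageOfInjOn f A h.1, fun {x y} => h.2 x x.2 y y.2⟩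
  have h2 : (M.induce (f '' A)).edgeSet.ncard = (H.induce A).edgeSet.ncard :=
    (Nat.card_congr e.mapEdgeSet).symm
  rw [preDim, preDim, h2, h.1.ncard_image]

theorem preDim_eq_of_adj {G M : SimpleGraph V} {A : Set V}
    (h : ∀ x ∈ A, ∀ y ∈ A, M.Adj x y ↔ G.Adj x y) : preDim α M A = preDim α G A := by
  simpa using preDim_image (α := α) (isEmbOn_id h)

/-- The edges of `M` with both ends in `A`. -/
def edgesIn (M : SimpleGraph V) (A : Set V) : Set (Sym2 V) := {e ∈ M.edgeSet | ∀ v ∈ e, v ∈ A}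

theorem mk_mem_edgesIn {A : Set V} {x y : V} :
    s(x, y) ∈ M.edgesIn A ↔ M.Adj x y ∧ x ∈ A ∧ y ∈ A := by
  simp [edgesIn]

/-- Counting edges inside `Sym2 V`, rather than over the subtype `A`, lets edge sets for different
`A` be intersected and united. -/
theorem preDim_eq (α : ℝ) (M : SimpleGraph V) (A : Set V) :
    preDim α M A = A.ncard - α * (M.edgesIn A).ncard := by
  have h : M.edgesIn A = Sym2.map Subtype.val '' (M.induce A).edgeSet := by
    ext e
    induction e with | _ x y
    rw [mk_mem_edgesIn]
    constructor
    · rintro ⟨h, hx, hy⟩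
      exact ⟨s(⟨x, hx⟩, ⟨y, hy⟩), h, rfl⟩
    · rintro ⟨e, he, h⟩
      induction e with | _ a b
      have hab : M.Adj a b := he
      rw [Sym2.map_mk, Sym2.eq_iff] at h
      rcases h with ⟨rfl, rfl⟩ | ⟨rfl, rfl⟩
      · exact ⟨hab, a.2, b.2⟩
      · exact ⟨hab.symm, b.2, a.2⟩
  rw [h, Set.ncard_image_of_injective _ (Sym2.map.injective Subtype.val_injective), preDim]

theorem edgesIn_finite (M : SimpleGraph V) {A : Set V} (hA : A.Finite) : (M.edgesIn A).Finite := by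
  refine ((hA.prod hA).image fun p => s(p.1, p.2)).subset fun e he => ?_
  induction e with | _ x y
  rw [mk_mem_edgesIn] at he
  exact ⟨(x, y), he.2, rfl⟩

theorem edgesIn_inter (M : SimpleGraph V) (X Y : Set V) :
    M.edgesIn (X ∩ Y) = M.edgesIn X ∩ M.edgesIn Y := by
  ext e
  induction e with | _ x y
  simp only [mk_mem_edgesIn, Set.mem_inter_iff]
  tauto

theorem edgesIn_union_subset (M : SimpleGraph V) (X Y : Set V) :
    M.edgesIn X ∪ M.edgesIn Y ⊆ M.edgesIn (X ∪ Y) := by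
  intro e
  induction e with | _ x y
  simp only [mk_mem_edgesIn, Set.mem_union]
  tauto

/-- Submodularity: vertex counts are modular, while `X ∪ Y` may also have edges crossing between `X
\ Y` and `Y \ X`, which only lower its pre-dimension. -/
theorem preDim_union_add_inter_le (hα : 0 ≤ α) (M : SimpleGraph V) {X Y : Set V} (hX : X.Finite)
    (hY : Y.Finite) :
    preDim α M (X ∪ Y) + preDim α M (X ∩ Y) ≤ preDim α M X + preDim α M Y := by
  have h1 : ((X ∪ Y).ncard : ℝ) + (X ∩ Y).ncard = X.ncard + Y.ncard := by
    exact_mod_cast Set.ncard_union_add_ncard_inter X Y hX hY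
  have h2 : ((M.edgesIn X).ncard : ℝ) + (M.edgesIn Y).ncard
      ≤ (M.edgesIn (X ∪ Y)).ncard + (M.edgesIn (X ∩ Y)).ncard := by
    rw [edgesIn_inter]
    exact_mod_cast (Set.ncard_union_add_ncard_inter _ _ (M.edgesIn_finite hX)
      (M.edgesIn_finite hY)).symm.le.trans (Nat.add_le_add_right (Set.ncard_le_ncard
        (M.edgesIn_union_subset X Y) (M.edgesIn_finite (hX.union hY))) _)
  simp only [preDim_eq]
  nlinarith [mul_le_mul_of_nonneg_left h2 hα]

theorem preDim_union_add_inter (α : ℝ) (M : SimpleGraph V) {X Y : Set V} (hX : X.Finite)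
    (hY : Y.Finite) (hfree : ∀ x ∈ X, ∀ y ∈ Y, M.Adj x y → x ∈ Y ∨ y ∈ X) :
    preDim α M (X ∪ Y) + preDim α M (X ∩ Y) = preDim α M X + preDim α M Y := by
  have h1 : ((X ∪ Y).ncard : ℝ) + (X ∩ Y).ncard = X.ncard + Y.ncard := by
    exact_mod_cast Set.ncard_union_add_ncard_inter X Y hX hY
  have h3 : M.edgesIn (X ∪ Y) = M.edgesIn X ∪ M.edgesIn Y := by
    refine Set.Subset.antisymm (fun e => ?_) (M.edgesIn_union_subset X Y)
    induction e with | _ x y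
    simp only [mk_mem_edgesIn, Set.mem_union]
    rintro ⟨h, hx, hy⟩
    have := hfree x
    have := hfree y
    have := h.symm
    grind
  have h2 : ((M.edgesIn (X ∪ Y)).ncard : ℝ) + (M.edgesIn (X ∩ Y)).ncard =
      (M.edgesIn X).ncard + (M.edgesIn Y).ncard := by
    rw [edgesIn_inter, h3]
    exact_mod_cast Set.ncard_union_add_ncard_inter _ _ (M.edgesIn_finite hX) (M.edgesIn_finite hY)
  simp only [preDim_eq]
  linear_combination h1 - α * h2

theorem preDim_empty (α : ℝ) (M : SimpleGraph V) : preDim α M ∅ = 0 := by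
  have : M.edgesIn ∅ = ∅ := by
    ext e
    induction e with | _ x y
    simp [mk_mem_edgesIn]
  simp [preDim_eq, this]

theorem preDim_singleton (α : ℝ) (M : SimpleGraph V) (v : V) : preDim α M {v} = 1 := by
  have : M.edgesIn {v} = ∅ := by
    ext e
    induction e with | _ x y
    simp only [mk_mem_edgesIn, Set.mem_singleton_iff, Set.mem_empty_iff_false, iff_false]
    rintro ⟨h, rfl, rfl⟩
    exact M.loopless.irrefl _ h
  simp [preDim_eq, this]

/-- Submodularity gives `δ(X) - δ(X ∩ A) ≥ δ(X ∪ A) - δ(A) ≥ 0`. Transitivity, free amalgamation and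
heredity of `K_α` all rest on this. -/
theorem IsStrongIn.preDim_inter_le {A B X : Set V} (hα : 0 ≤ α) (h : IsStrongIn α M A B)
    (hB : B.Finite) (hX : X ⊆ B) : preDim α M (X ∩ A) ≤ preDim α M X := by
  have h1 := preDim_union_add_inter_le hα M (hB.subset hX) (hB.subset h.1)
  have h2 := h.2 (X ∪ A) Set.subset_union_right (Set.union_subset hX h.1)
  linarith

theorem isStrongIn_refl (α : ℝ) (M : SimpleGraph V) (A : Set V) : IsStrongIn α M A A :=
  ⟨subset_rfl, fun C h1 h2 => by rw [h1.antisymm h2]; simp⟩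

theorem IsStrongIn.trans {A B C : Set V} (hα : 0 ≤ α) (hC : C.Finite) (h1 : IsStrongIn α M A B)
    (h2 : IsStrongIn α M B C) : IsStrongIn α M A C := by
  refine ⟨h1.1.trans h2.1, fun D hAD hDC => ?_⟩
  have h3 := h2.preDim_inter_le hα hC hDC
  have h4 := h1.2 (D ∩ B) (Set.subset_inter hAD h1.1) Set.inter_subset_right
  linarith

theorem IsStrongIn.image {f : W → V} {A B : Set W} (hf : IsEmbOn H M f B)
    (h : IsStrongIn α H A B) : IsStrongIn α M (f '' A) (f '' B) := by
  refine ⟨Set.image_mono h.1, fun C h1 h2 => ?_⟩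
  obtain ⟨D, hD, rfl⟩ := Set.subset_image_iff.1 h2
  rw [preDim_image (hf.mono hD), preDim_image (hf.mono h.1)]
  refine h.2 D (fun x hx => ?_) hD
  obtain ⟨y, hy, hxy⟩ := h1 (Set.mem_image_of_mem f hx)
  rwa [← hf.1 (hD hy) (h.1 hx) hxy]

theorem IsStrongIn.of_image {f : W → V} {A B : Set W} (hf : IsEmbOn H M f B) (hAB : A ⊆ B)
    (h : IsStrongIn α M (f '' A) (f '' B)) : IsStrongIn α H A B := by
  refine ⟨hAB, fun C h1 h2 => ?_⟩
  rw [← preDim_image (hf.mono h2), ← preDim_image (hf.mono hAB)]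
  exact h.2 _ (Set.image_mono h1) (Set.image_mono h2)

theorem isStrong_iff {A : Set V} : IsStrong α M A ↔
    A.Finite ∧ ∀ C : Set V, C.Finite → A ⊆ C → preDim α M A ≤ preDim α M C := by
  refine and_congr_right fun _ => ⟨fun h C hC hAC => ?_, fun h B hB hAB => ⟨hAB, fun C h1 h2 => ?_⟩⟩
  · exact sub_nonneg.1 ((h C hC hAC).2 C hAC subset_rfl)
  · exact sub_nonneg.2 (h C (hB.subset h2) h1)

theorem IsStrongIn.trans_isStrong {A B : Set V} (hα : 0 ≤ α) (h1 : IsStrongIn α M A B)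
    (h2 : IsStrong α M B) : IsStrong α M A := by
  rw [isStrong_iff]
  refine ⟨h2.1.subset h1.1, fun C hC hAC => ?_⟩
  have h3 := h1.trans hα (h2.1.union hC) (h2.2 (B ∪ C) (h2.1.union hC) Set.subset_union_left)
  exact sub_nonneg.1 (h3.2 C hAC Set.subset_union_right)

/-- Free amalgamation: if `X ∩ Y ≤ Y` and there are no edges between `X \ Y` and `Y \ X`, then
`X ≤ X ∪ Y`. -/
theorem IsStrongIn.union (hα : 0 ≤ α) {X Y : Set V} (hX : X.Finite) (hY : Y.Finite)
    (hfree : ∀ x ∈ X, ∀ y ∈ Y, M.Adj x y → x ∈ Y ∨ y ∈ X) (h : IsStrongIn α M (X ∩ Y) Y) :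
    IsStrongIn α M X (X ∪ Y) := by
  refine ⟨Set.subset_union_left, fun C h1 h2 => ?_⟩
  -- `C` is itself a free union of `X` and `C ∩ Y`, so its excess over `X` equals that of `C ∩ Y`
  -- over `X ∩ Y`.
  have h3 : X ∪ (C ∩ Y) = C := by
    ext v
    have := @h1 v
    have := @h2 v
    simp only [Set.mem_union, Set.mem_inter_iff] at *
    tauto
  have h4 := preDim_union_add_inter α M hX (hY.subset (Set.inter_subset_right (s := C)))
    (fun x hx y hy hxy => (hfree x hx y hy.2 hxy).imp (fun h => ⟨h1 hx, h⟩) id)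
  have h5 := h.preDim_inter_le hα hY (Set.inter_subset_right (s := C))
  have h6 : C ∩ Y ∩ (X ∩ Y) = X ∩ (C ∩ Y) := by
    ext v; simp only [Set.mem_inter_iff]; tauto
  rw [h3] at h4
  rw [h6] at h5
  linarith

/-- Strong extensions of members of `K_α` are in `K_α`. -/
theorem IsStrongIn.preDim_nonneg (hα : 0 ≤ α) {X Y : Set V} (hY : Y.Finite)
    (h : IsStrongIn α M X Y) (hX : ∀ A ⊆ X, 0 ≤ preDim α M A) {A : Set V} (hA : A ⊆ Y) :
    0 ≤ preDim α M A :=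
  (hX _ Set.inter_subset_right).trans (h.preDim_inter_le hα hY hA)

end PreDim

/-! ### Strong amalgamation and construction of the generic graph. -/

section Existence

variable {α : ℝ}

/-- A member of `K_α` with a finite set of natural numbers as its vertices. -/
structure FinGraph (α : ℝ) where
  /-- the vertices -/
  supp : Finset ℕ
  /-- the edges -/
  graph : SimpleGraph ℕ
  mem_supp : ∀ x y, graph.Adj x y → x ∈ supp
  nonneg : ∀ A : Set ℕ, A ⊆ supp → 0 ≤ preDim α graph A

namespace FinGraph

/-- `p` is a strong induced subgraph of `q`. -/
def IsExt (p q : FinGraph α) : Prop :=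
  IsStrongIn α q.graph p.supp q.supp ∧
    ∀ x ∈ p.supp, ∀ y ∈ p.supp, q.graph.Adj x y ↔ p.graph.Adj x y

theorem IsExt.isEmbOn {p q : FinGraph α} (h : p.IsExt q) :
    IsEmbOn p.graph q.graph id p.supp := isEmbOn_id h.2

theorem IsExt.isStrongIn {p q : FinGraph α} (h : p.IsExt q) {A B : Set ℕ}
    (hB : B ⊆ p.supp) (hAB : IsStrongIn α p.graph A B) : IsStrongIn α q.graph A B := by
  simpa using hAB.image (h.isEmbOn.mono hB)

/-- The preorder of strong extension. -/
@[reducible] def preorder (hα : 0 ≤ α) : Preorder (FinGraph α) where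
  le := IsExt
  le_refl p := ⟨isStrongIn_refl _ _ _, fun _ _ _ _ => Iff.rfl⟩
  le_trans p q r h1 h2 := by
    have h3 : p.supp ⊆ q.supp := by exact_mod_cast h1.1.1
    exact ⟨(h2.isStrongIn subset_rfl h1.1).trans hα r.supp.finite_toSet h2.1,
      fun x hx y hy => (h2.2 x (h3 hx) y (h3 hy)).trans (h1.2 x hx y hy)⟩

/-- A missing vertex is added as an isolated point, a free amalgam over the empty set. -/
theorem exists_isExt_insert (hα : 0 ≤ α) (p : FinGraph α) (n : ℕ) :
    ∃ q : FinGraph α, p.IsExt q ∧ n ∈ q.supp := by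
  by_cases hn : n ∈ p.supp
  · exact ⟨p, ⟨isStrongIn_refl _ _ _, fun _ _ _ _ => Iff.rfl⟩, hn⟩
  have h0 : (p.supp : Set ℕ) ∩ {n} = ∅ := by simpa using hn
  have h1 : IsStrongIn α p.graph p.supp (p.supp ∪ {n}) := by
    refine IsStrongIn.union hα p.supp.finite_toSet (Set.finite_singleton n)
      (fun x _ y _ hxy => Or.inr (p.mem_supp _ _ hxy.symm)) ?_
    rw [h0]
    refine ⟨Set.empty_subset _, fun C _ hC => ?_⟩
    rcases Set.subset_singleton_iff_eq.1 hC with rfl | rfl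
    · simp
    · rw [preDim_singleton, preDim_empty]; norm_num
  refine ⟨⟨p.supp ∪ {n}, p.graph, fun x y h => Finset.mem_union_left _ (p.mem_supp x y h),
    fun A hA => h1.preDim_nonneg hα (p.supp.finite_toSet.union (Set.finite_singleton n)) p.nonneg
      (by simpa using hA)⟩, ⟨by simpa using h1, fun _ _ _ _ => Iff.rfl⟩, by simp⟩

theorem exists_isExt_subset (hα : 0 ≤ α) (p : FinGraph α) (T : Finset ℕ) :
    ∃ q : FinGraph α, p.IsExt q ∧ T ⊆ q.supp := by
  let := preorder hα
  induction T using Finset.induction_on with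
  | empty => exact ⟨p, le_refl p, by simp⟩
  | insert n T _ ih =>
    obtain ⟨q, hq, hT⟩ := ih
    obtain ⟨r, hr, hn⟩ := exists_isExt_insert hα q n
    have hqr : q.supp ⊆ r.supp := by exact_mod_cast hr.1.1
    exact ⟨r, le_trans (b := q) hq hr, Finset.insert_subset hn (hT.trans hqr)⟩

/-- Strong amalgamation of `p` and a finite graph `H` over a common strong subgraph. -/
theorem exists_amalgam (hα : 0 ≤ α) (p : FinGraph α) {n : ℕ} {H : SimpleGraph (Fin n)}
    {A : Set (Fin n)} {f : Fin n → ℕ} (hA : IsStrongIn α H A Set.univ)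
    (hf : IsEmbOn H p.graph f A) (hfp : IsStrongIn α p.graph (f '' A) p.supp) :
    ∃ q : FinGraph α, p.IsExt q ∧ ∃ g : Fin n → ℕ, Set.EqOn f g A ∧
      IsEmbOn H q.graph g Set.univ ∧ IsStrongIn α q.graph (g '' Set.univ) q.supp := by
  classical
  obtain ⟨N, hN⟩ : ∃ N, ∀ x ∈ p.supp, x < N :=
    ⟨p.supp.sup id + 1, fun x hx => Nat.lt_succ_of_le (Finset.le_sup (f := id) hx)⟩
  -- Vertices outside `A` go beyond the support of `p`, so the copy of `H` meets `p` exactly in the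
  -- image of `A`.
  let g : Fin n → ℕ := fun x => if x ∈ A then f x else N + x
  have hgA : ∀ x ∈ A, g x = f x := fun x hx => if_pos hx
  have hgnA : ∀ x, x ∉ A → g x = N + x := fun x hx => if_neg hx
  have hfS : ∀ x ∈ A, f x ∈ p.supp := fun x hx => hfp.1 (Set.mem_image_of_mem f hx)
  have hgS : ∀ x, g x ∈ p.supp → x ∈ A := by
    intro x hx
    by_contra hxA
    have := hN _ hx
    rw [hgnA x hxA] at this
    omega
  have hginj : Function.Injective g := by
    intro x y hxy
    by_cases hx : x ∈ A
    · have hy : y ∈ A := hgS y (hxy ▸ hgA x hx ▸ hfS x hx)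
      rw [hgA x hx, hgA y hy] at hxy
      exact hf.1 hx hy hxy
    · have hy : y ∉ A := fun hy => hx (hgS x (hxy ▸ hgA y hy ▸ hfS y hy))
      rw [hgnA x hx, hgnA y hy] at hxy
      exact Fin.ext (by omega)
  let G : SimpleGraph ℕ := p.graph ⊔ H.map g
  have hG : ∀ x y, G.Adj x y ↔ p.graph.Adj x y ∨ ∃ a b, H.Adj a b ∧ g a = x ∧ g b = y :=
    fun x y => or_congr Iff.rfl (SimpleGraph.map_adj ⟨g, hginj⟩ H x y)
  have hGS : ∀ x ∈ p.supp, ∀ y ∈ p.supp, G.Adj x y ↔ p.graph.Adj x y := by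
    intro x hx y hy
    rw [hG, or_iff_left_iff_imp]
    rintro ⟨a, b, hab, rfl, rfl⟩
    have ha := hgS a hx
    have hb := hgS b hy
    rw [hgA a ha, hgA b hb]
    exact (hf.2 a ha b hb).2 hab
  have hGg : IsEmbOn H G g Set.univ := by
    refine ⟨hginj.injOn, fun a _ b _ => ?_⟩
    rw [hG]
    constructor
    · rintro (h | ⟨a', b', h, ha, hb⟩)
      · have ha := hgS a (p.mem_supp _ _ h)
        have hb := hgS b (p.mem_supp _ _ h.symm)
        rw [hgA a ha, hgA b hb] at h
        exact (hf.2 a ha b hb).1 h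
      · rwa [← hginj ha, ← hginj hb]
    · exact fun h => Or.inr ⟨a, b, h, rfl, rfl⟩
  have hfg : f '' A = g '' A := Set.image_congr fun x hx => (hgA x hx).symm
  have hinter : (p.supp : Set ℕ) ∩ g '' Set.univ = g '' A := by
    ext x
    constructor
    · rintro ⟨hx, a, -, rfl⟩
      exact ⟨a, hgS a hx, rfl⟩
    · rintro ⟨a, ha, rfl⟩
      exact ⟨hgA a ha ▸ hfS a ha, a, trivial, rfl⟩
  have hfin : (g '' Set.univ).Finite := Set.finite_univ.image g
  have hfree : ∀ x ∈ (p.supp : Set ℕ), ∀ y ∈ g '' Set.univ, G.Adj x y →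
      x ∈ g '' Set.univ ∨ y ∈ (p.supp : Set ℕ) := by
    intro x _ y _ hxy
    rcases (hG x y).1 hxy with h | ⟨a, b, -, rfl, -⟩
    · exact Or.inr (p.mem_supp _ _ h.symm)
    · exact Or.inl ⟨a, trivial, rfl⟩
  have hS1 : IsStrongIn α G p.supp (p.supp ∪ g '' Set.univ) := by
    refine IsStrongIn.union hα p.supp.finite_toSet hfin hfree ?_
    rw [hinter]
    exact hA.image hGg
  have hS2 : IsStrongIn α G (g '' Set.univ) (g '' Set.univ ∪ p.supp) := by
    refine IsStrongIn.union hα hfin p.supp.finite_toSet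
      (fun x hx y hy h => (hfree y hy x hx h.symm).symm) ?_
    rw [Set.inter_comm, hinter, ← hfg]
    simpa using hfp.image (isEmbOn_id (M := G) hGS)
  have hco : ((p.supp ∪ Finset.univ.image g : Finset ℕ) : Set ℕ) =
      (p.supp : Set ℕ) ∪ g '' Set.univ := by simp
  rw [← hco] at hS1
  rw [Set.union_comm, ← hco] at hS2
  refine ⟨⟨p.supp ∪ Finset.univ.image g, G, ?_, fun B hB => ?_⟩, ⟨?_, hGS⟩, g,
    fun x hx => (hgA x hx).symm, hGg, ?_⟩
  · intro x y hxy
    rcases (hG x y).1 hxy with h | ⟨a, b, -, rfl, -⟩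
    · exact Finset.mem_union_left _ (p.mem_supp _ _ h)
    · exact Finset.mem_union_right _ (Finset.mem_image_of_mem g (Finset.mem_univ a))
  · refine hS1.preDim_nonneg hα (Finset.finite_toSet _) (fun A hA => ?_) hB
    rw [preDim_eq_of_adj fun x hx y hy => hGS x (hA hx) y (hA hy)]
    exact p.nonneg A hA
  · exact hS1
  · exact hS2

/-- The extension problem `H` over `f : A → ℕ` is solved in `p`. -/
def Solves (p : FinGraph α) {n : ℕ} (H : SimpleGraph (Fin n)) (A : Set (Fin n))
    (f : Fin n → ℕ) : Prop :=
  -- The first conjunct excludes stages too small to contain the base, where the implication would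
  -- hold vacuously.
  f '' A ⊆ p.supp ∧ (IsStrongIn α H A Set.univ → IsEmbOn H p.graph f A →
    IsStrongIn α p.graph (f '' A) p.supp → ∃ g : Fin n → ℕ, Set.EqOn f g A ∧
      IsEmbOn H p.graph g Set.univ ∧ IsStrongIn α p.graph (g '' Set.univ) p.supp)

theorem exists_isExt_solves (hα : 0 ≤ α) (p : FinGraph α) {n : ℕ} (H : SimpleGraph (Fin n))
    (A : Set (Fin n)) (f : Fin n → ℕ) : ∃ q : FinGraph α, p.IsExt q ∧ q.Solves H A f := by
  classical
  let := preorder hα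
  obtain ⟨q, hpq, hq⟩ := exists_isExt_subset hα p (Finset.univ.image f)
  have hAq : f '' A ⊆ q.supp := by
    rintro _ ⟨x, -, rfl⟩
    exact hq (Finset.mem_image_of_mem f (Finset.mem_univ x))
  by_cases h : IsStrongIn α H A Set.univ ∧ IsEmbOn H q.graph f A ∧
      IsStrongIn α q.graph (f '' A) q.supp
  · obtain ⟨r, hr, g, hg⟩ := exists_amalgam hα q h.1 h.2.1 h.2.2
    exact ⟨r, le_trans (b := q) hpq hr, hAq.trans hr.1.1, fun _ _ _ => ⟨g, hg⟩⟩
  · exact ⟨q, hpq, hAq, fun h1 h2 h3 => absurd ⟨h1, h2, h3⟩ h⟩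

/-- A sequence of strong extensions meeting all requirements. -/
theorem exists_sequence (hα : 0 ≤ α) : ∃ p : ℕ → FinGraph α,
    (∀ i j, i ≤ j → (p i).IsExt (p j)) ∧ (∀ n, ∃ i, n ∈ (p i).supp) ∧
      ∀ (n : ℕ) (H : SimpleGraph (Fin n)) (A : Set (Fin n)) (f : Fin n → ℕ),
        ∃ i, (p i).Solves H A f := by
  let := preorder hα
  -- Taking `f` as a total function on `Fin n` keeps the set of all extension problems visibly
  -- countable.
  let ι := ℕ ⊕ (Σ n : ℕ, SimpleGraph (Fin n) × Set (Fin n) × (Fin n → ℕ))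
  let : Encodable ι := Encodable.ofCountable ι
  let D : ι → Order.Cofinal (FinGraph α) := fun t => match t with
    | Sum.inl n => ⟨{q | n ∈ q.supp}, fun p =>
        (exists_isExt_insert hα p n).imp fun q hq => ⟨hq.2, hq.1⟩⟩
    | Sum.inr t => ⟨{q | q.Solves t.2.1 t.2.2.1 t.2.2.2}, fun p =>
        (exists_isExt_solves hα p t.2.1 t.2.2.1 t.2.2.2).imp fun q hq => ⟨hq.2, hq.1⟩⟩
  let p0 : FinGraph α := ⟨∅, ⊥, fun _ _ h => h.elim, fun A hA => by
    have : A = ∅ := by simpa using hA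
    rw [this, preDim_empty]⟩
  exact ⟨Order.sequenceOfCofinals p0 D,
    fun i j hij => Order.sequenceOfCofinals.monotone p0 D hij,
    fun n => ⟨_, Order.sequenceOfCofinals.encode_mem p0 D (Sum.inl n)⟩,
    fun n H A f => ⟨_, Order.sequenceOfCofinals.encode_mem p0 D (Sum.inr ⟨n, H, A, f⟩)⟩⟩

end FinGraph

theorem exists_isGeneric (hα : 0 ≤ α) : ∃ M : SimpleGraph ℕ, M.IsGeneric α := by
  obtain ⟨p, hmono, hmem, hsolve⟩ := FinGraph.exists_sequence hα
  have hsub : ∀ i j, i ≤ j → (p i).supp ⊆ (p j).supp := fun i j hij => by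
    exact_mod_cast (hmono i j hij).1.1
  have hadj : ∀ i j, ∀ x ∈ (p i).supp, ∀ y ∈ (p i).supp,
      (p j).graph.Adj x y → (p i).graph.Adj x y := by
    intro i j x hx y hy h
    rcases le_total i j with hij | hij
    · exact ((hmono i j hij).2 x hx y hy).1 h
    -- An edge of the earlier graph has both ends in the smaller support, where the two graphs
    -- agree.
    · exact ((hmono j i hij).2 x ((p j).mem_supp _ _ h) y ((p j).mem_supp _ _ h.symm)).2 h
  let M : SimpleGraph ℕ :=
    { Adj := fun x y => ∃ i, (p i).graph.Adj x y
      symm := ⟨fun x y ⟨i, h⟩ => ⟨i, h.symm⟩⟩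
      loopless := ⟨fun x ⟨i, h⟩ => (p i).graph.loopless.irrefl x h⟩ }
  have hM : ∀ i, ∀ x ∈ (p i).supp, ∀ y ∈ (p i).supp, M.Adj x y ↔ (p i).graph.Adj x y :=
    fun i x hx y hy => ⟨fun ⟨j, h⟩ => hadj i j x hx y hy h, fun h => ⟨i, h⟩⟩
  have hcover : ∀ B : Set ℕ, B.Finite → ∀ i, ∃ j, i ≤ j ∧ B ⊆ (p j).supp := by
    intro B hB i
    induction B, hB using Set.Finite.induction_on with
    | empty => exact ⟨i, le_rfl, Set.empty_subset _⟩
    | @insert a s _ _ ih =>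
      obtain ⟨j, hij, hj⟩ := ih
      obtain ⟨k, hk⟩ := hmem a
      refine ⟨max j k, hij.trans (le_max_left _ _), Set.insert_subset ?_ ?_⟩
      · exact hsub _ _ (le_max_right j k) hk
      · exact hj.trans (by exact_mod_cast hsub _ _ (le_max_left j k))
  have hdim : ∀ i, ∀ B : Set ℕ, B ⊆ (p i).supp → preDim α M B = preDim α (p i).graph B :=
    fun i B hB => preDim_eq_of_adj fun x hx y hy => hM i x (hB hx) y (hB hy)
  have hstrong : ∀ i, IsStrong α M (p i).supp := by
    intro i
    rw [isStrong_iff]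
    refine ⟨(p i).supp.finite_toSet, fun C hC hiC => ?_⟩
    obtain ⟨j, hij, hj⟩ := hcover C hC i
    rw [hdim j C hj, hdim j _ (hiC.trans hj)]
    exact sub_nonneg.1 ((hmono i j hij).1.2 C hiC hj)
  have hnonneg : ∀ B : Set ℕ, B.Finite → 0 ≤ preDim α M B := by
    intro B hB
    obtain ⟨j, -, hj⟩ := hcover B hB 0
    rw [hdim j B hj]
    exact (p j).nonneg B hj
  have hext : ∀ (W : Type) (H : SimpleGraph W), InClass α H →
      ∀ A : Set W, IsStrongIn α H A Set.univ →
      ∀ f : H.induce A ↪g M, IsStrong α M (Set.range f) →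
      ∃ Λ : H ↪g M, (∀ a : A, Λ a = f a) ∧ IsStrong α M (Set.range Λ) := by
    classical
    intro W H hH A hA f hf
    have := hH.1
    obtain ⟨n, ⟨e⟩⟩ := Finite.exists_equiv_fin W
    let H' : SimpleGraph (Fin n) := H.comap e.symm
    have he : IsEmbOn H' H e.symm Set.univ := ⟨e.symm.injective.injOn, fun _ _ _ _ => Iff.rfl⟩
    let A' : Set (Fin n) := e.symm ⁻¹' A
    have hA' : e.symm '' A' = A := Set.image_preimage_eq A e.symm.surjective
    -- The value 0 off `A'` is junk: only the restriction to `A'` is used.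
    let f' : Fin n → ℕ := fun x => if h : e.symm x ∈ A then f ⟨e.symm x, h⟩ else 0
    have hf'A : ∀ x (h : e.symm x ∈ A), f' x = f ⟨e.symm x, h⟩ := fun x h => dif_pos h
    have hf'range : f' '' A' = Set.range f := by
      ext v
      constructor
      · rintro ⟨x, hx, rfl⟩
        exact ⟨_, (hf'A x hx).symm⟩
      · rintro ⟨a, rfl⟩
        have ha : e.symm (e a) ∈ A := by simp
        refine ⟨e a, ha, ?_⟩
        rw [hf'A _ ha]
        simp
    -- At this stage the problem is genuinely posed: embedding and strongness in `M` restrict to `p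
    -- i`. The solution is strong in `p i`, which is strong in `M`.
    obtain ⟨i, hi, hs⟩ := hsolve n H' A' f'
    have h1 : IsStrongIn α H' A' Set.univ := by
      refine IsStrongIn.of_image he (Set.subset_univ _) ?_
      rwa [hA', Set.image_univ, e.symm.range_eq_univ]
    have hMi : IsEmbOn (p i).graph M id (p i).supp := isEmbOn_id (hM i)
    have h2 : IsEmbOn H' (p i).graph f' A' := by
      refine ⟨fun x hx y hy hxy => ?_, fun x hx y hy => ?_⟩
      · rw [hf'A x hx, hf'A y hy] at hxy
        simpa using f.injective hxy
      · rw [← hM i _ (hi (Set.mem_image_of_mem _ hx)) _ (hi (Set.mem_image_of_mem _ hy)),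
          hf'A x hx, hf'A y hy]
        exact f.map_adj_iff
    have h3 : IsStrongIn α (p i).graph (f' '' A') (p i).supp := by
      refine IsStrongIn.of_image hMi hi ?_
      simp only [Set.image_id]
      rw [hf'range] at hi ⊢
      exact hf.2 _ (p i).supp.finite_toSet hi
    obtain ⟨g, hfg, hg, hgs⟩ := hs h1 h2 h3
    have hgM : IsEmbOn H' M g Set.univ := by
      simpa using (hMi.mono hgs.1).comp hg
    refine ⟨⟨⟨fun w => g (e w), fun x y hxy => e.injective (hg.1 trivial trivial hxy)⟩,
      fun {x y} => ?_⟩, fun a => ?_, ?_⟩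
    · exact (hgM.2 (e x) trivial (e y) trivial).trans (by simp [H'])
    · have ha : e.symm (e a) ∈ A := by simp
      change g (e a) = f a
      rw [← hfg ha, hf'A _ ha]
      simp
    · have hr : g '' Set.univ = Set.range fun w => g (e w) := by
        rw [Set.image_univ]
        exact (e.surjective.range_comp g).symm
      change IsStrong α M (Set.range fun w => g (e w))
      rw [← hr]
      refine IsStrongIn.trans_isStrong hα ?_ (hstrong i)
      simpa using hgs.image hMi
  have hempty : IsStrong α M ∅ := by
    rw [isStrong_iff]
    refine ⟨Set.finite_empty, fun C hC _ => ?_⟩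
    rw [preDim_empty]
    exact hnonneg C hC
  refine ⟨M, inferInstance, fun A hA => ?_, fun W H hH => ?_, ?_, hext⟩
  · refine ⟨hA, fun B => ?_⟩
    rw [← preDim_image (isEmbOn_val M A B)]
    exact hnonneg _ (hA.subset (by simp))
  · have h0 : IsStrongIn α H ∅ Set.univ :=
      ⟨Set.empty_subset _, fun C _ _ => by rw [preDim_empty, sub_zero]; exact hH.2 C⟩
    let f : H.induce (∅ : Set W) ↪g M := ⟨⟨fun x => x.2.elim, fun x => x.2.elim⟩, fun {x} => x.2.elim⟩
    obtain ⟨Λ, -⟩ := hext W H hH ∅ h0 f (by rwa [Set.range_eq_empty])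
    exact ⟨Λ⟩
  · refine ⟨fun i => (p i).supp, fun i j hij => hsub i j hij, hstrong, ?_⟩
    exact Set.iUnion_eq_univ_iff.2 hmem

end Existence

/-! ### Back-and-forth between strong finite subsets. -/

section Homogeneity

variable {V : Type u} {α : ℝ} {M : SimpleGraph V}

theorem IsGeneric.exists_isStrong_superset (hM : M.IsGeneric α) {A : Set V} (hA : A.Finite) :
    ∃ B, A ⊆ B ∧ IsStrong α M B := by
  obtain ⟨S, hmono, hS, hU⟩ := hM.exists_chain
  suffices h : ∃ i, A ⊆ S i from h.imp' S fun i hi => ⟨hi, hS i⟩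
  induction A, hA using Set.Finite.induction_on with
  | empty => exact ⟨0, Set.empty_subset _⟩
  | @insert a s _ _ ih =>
    obtain ⟨j, hj⟩ := ih
    obtain ⟨k, hk⟩ := Set.iUnion_eq_univ_iff.1 hU a
    exact ⟨max j k, Set.insert_subset (hmono (le_max_right j k) hk)
      (hj.trans (hmono (le_max_left j k)))⟩

/-- The extension axiom concerns abstract graphs in `Type`. Copying `B` to `Fin n` makes it
available for subsets of `M`, in any universe. -/
theorem IsGeneric.exists_extension (hM : M.IsGeneric α) {A B : Set V} (hB : B.Finite)
    (hAB : IsStrongIn α M A B) {f : V → V} (hf : IsEmbOn M M f A) (hs : IsStrong α M (f '' A)) :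
    ∃ g : V → V, Set.EqOn f g A ∧ IsEmbOn M M g B ∧ IsStrong α M (g '' B) := by
  classical
  have := hB.to_subtype
  obtain ⟨n, ⟨e⟩⟩ := Finite.exists_equiv_fin B
  let ι : Fin n → V := fun i => e.symm i
  have hιe : ∀ b : B, ι (e b) = b := fun b => by simp [ι]
  let H : SimpleGraph (Fin n) := M.comap ι
  have hι : IsEmbOn H M ι Set.univ :=
    ⟨(Subtype.val_injective.comp e.symm.injective).injOn, fun _ _ _ _ => Iff.rfl⟩
  have hιB : ι '' Set.univ = B := by
    rw [Set.image_univ]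
    change Set.range (Subtype.val ∘ e.symm) = B
    rw [e.symm.surjective.range_comp, Subtype.range_coe]
  have hιA : ι '' (ι ⁻¹' A) = A :=
    Set.image_preimage_eq_of_subset (by rw [← Set.image_univ, hιB]; exact hAB.1)
  have hH : InClass α H := by
    refine ⟨inferInstance, fun C => ?_⟩
    have hC : (ι '' C).Finite := C.toFinite.image ι
    rw [← preDim_image (hι.mono (Set.subset_univ C))]
    have := (hM.age_subset _ hC).2 Set.univ
    rwa [← preDim_image (isEmbOn_val M _ _), Set.image_univ, Subtype.range_coe] at this
  have hA' : IsStrongIn α H (ι ⁻¹' A) Set.univ :=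
    IsStrongIn.of_image hι (Set.subset_univ _) (by rwa [hιA, hιB])
  have hf' : IsEmbOn H M (f ∘ ι) (ι ⁻¹' A) :=
    IsEmbOn.comp (by rwa [hιA]) (hι.mono (Set.subset_univ _))
  have hr : Set.range hf'.toEmbedding = f '' A := by
    rw [hf'.range_toEmbedding, Set.image_comp, hιA]
  obtain ⟨Λ, hΛ, hΛs⟩ := hM.extension (Fin n) H hH _ hA' hf'.toEmbedding (hr ▸ hs)
  let g : V → V := fun v => if h : v ∈ B then Λ (e ⟨v, h⟩) else v
  have hg : ∀ b : B, g b = Λ (e b) := fun b => dif_pos b.2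
  refine ⟨g, fun a ha => ?_, ⟨fun x hx y hy hxy => ?_, fun x hx y hy => ?_⟩, ?_⟩
  · have h1 : ι (e ⟨a, hAB.1 ha⟩) = a := hιe ⟨a, hAB.1 ha⟩
    have h2 : ι (e ⟨a, hAB.1 ha⟩) ∈ A := by rwa [h1]
    have h3 := hΛ ⟨e ⟨a, hAB.1 ha⟩, h2⟩
    rw [hg ⟨a, hAB.1 ha⟩, h3]
    exact congrArg f h1.symm
  · rw [hg ⟨x, hx⟩, hg ⟨y, hy⟩] at hxy
    simpa using hxy
  · rw [hg ⟨x, hx⟩, hg ⟨y, hy⟩, Λ.map_adj_iff]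
    change M.Adj (ι _) (ι _) ↔ _
    rw [hιe, hιe]
  · have : g '' B = Set.range Λ := by
      rw [Set.image_eq_range, ← e.surjective.range_comp Λ]
      exact congrArg Set.range (funext hg)
    rwa [this]

/-- `R` is the graph of an isomorphism between two strong finite subsets of `M`. -/
structure IsStrongPartialIso (α : ℝ) (M : SimpleGraph V) (R : Set (V × V)) : Prop where
  inj : ∀ p ∈ R, ∀ q ∈ R, p.1 = q.1 ↔ p.2 = q.2
  adj : ∀ p ∈ R, ∀ q ∈ R, M.Adj p.1 q.1 ↔ M.Adj p.2 q.2
  strong_fst : IsStrong α M (Prod.fst '' R)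
  strong_snd : IsStrong α M (Prod.snd '' R)

theorem IsStrongPartialIso.swap {R : Set (V × V)} (h : IsStrongPartialIso α M R) :
    IsStrongPartialIso α M (Prod.swap ⁻¹' R) where
  inj p hp q hq := (h.inj _ hp _ hq).symm
  adj p hp q hq := (h.adj _ hp _ hq).symm
  strong_fst := by
    have := h.strong_snd
    rwa [← Set.image_swap_eq_preimage_swap, Set.image_image]
  strong_snd := by
    have := h.strong_fst
    rwa [← Set.image_swap_eq_preimage_swap, Set.image_image]

/-- The domain and `v` lie in a finite strong set `B`. The domain, being strong in `M`, is strong in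
`B`, so the partial map extends to all of `B`. -/
theorem IsGeneric.exists_mem_fst (hM : M.IsGeneric α) {R : Set (V × V)}
    (h : IsStrongPartialIso α M R) (v : V) :
    ∃ R', IsStrongPartialIso α M R' ∧ R ⊆ R' ∧ ∃ w, (v, w) ∈ R' := by
  classical
  obtain ⟨B, hAB, hB⟩ := hM.exists_isStrong_superset (h.strong_fst.1.insert v)
  rw [Set.insert_subset_iff] at hAB
  have hex : ∀ x, ∃ y, x ∈ Prod.fst '' R → (x, y) ∈ R := by
    intro x
    by_cases hx : x ∈ Prod.fst '' R
    · obtain ⟨⟨a, b⟩, hp, rfl⟩ := hx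
      exact ⟨b, fun _ => hp⟩
    · exact ⟨x, fun h => absurd h hx⟩
  choose f hf using hex
  have hR : ∀ p ∈ R, f p.1 = p.2 := fun p hp =>
    (h.inj _ (hf p.1 (Set.mem_image_of_mem _ hp)) _ hp).1 rfl
  have hsnd : f '' (Prod.fst '' R) = Prod.snd '' R := by
    rw [Set.image_image]
    exact Set.image_congr hR
  obtain ⟨g, hfg, hg, hgB⟩ := hM.exists_extension hB.1 (h.strong_fst.2 B hB.1 hAB.2) (f := f)
    ⟨fun x hx y hy hxy => (h.inj _ (hf x hx) _ (hf y hy)).2 hxy,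
      fun x hx y hy => (h.adj _ (hf x hx) _ (hf y hy)).symm⟩ (by rw [hsnd]; exact h.strong_snd)
  refine ⟨(fun x => (x, g x)) '' B, ⟨?_, ?_, ?_, ?_⟩, fun p hp => ?_, g v, v, hAB.1, rfl⟩
  · rintro _ ⟨x, hx, rfl⟩ _ ⟨y, hy, rfl⟩
    exact (hg.1.eq_iff hx hy).symm
  · rintro _ ⟨x, hx, rfl⟩ _ ⟨y, hy, rfl⟩
    exact (hg.2 x hx y hy).symm
  · rw [Set.image_image]
    simpa using hB
  · rw [Set.image_image]
    exact hgB
  · have h1 : p.1 ∈ Prod.fst '' R := Set.mem_image_of_mem _ hp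
    refine ⟨p.1, hAB.2 h1, Prod.ext rfl ?_⟩
    rw [← hR p hp]
    exact (hfg h1).symm

theorem IsGeneric.exists_mem_snd (hM : M.IsGeneric α) {R : Set (V × V)}
    (h : IsStrongPartialIso α M R) (w : V) :
    ∃ R', IsStrongPartialIso α M R' ∧ R ⊆ R' ∧ ∃ v, (v, w) ∈ R' := by
  obtain ⟨R', h1, h2, v, hv⟩ := hM.exists_mem_fst h.swap w
  exact ⟨_, h1.swap, fun p hp => h2 (show p.swap.swap ∈ R by simpa using hp), v, hv⟩

/-- Isomorphisms between strong finite subsets of a generic graph extend to automorphisms. -/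
theorem IsGeneric.exists_aut (hM : M.IsGeneric α) {R : Set (V × V)}
    (hR : IsStrongPartialIso α M R) : ∃ g : M ≃g M, ∀ p ∈ R, g p.1 = p.2 := by
  have := hM.countable
  let P := {R : Set (V × V) // IsStrongPartialIso α M R}
  let : Encodable (V ⊕ V) := Encodable.ofCountable _
  -- The left copy of `V` asks for points of the domain (forth), the right copy for points of the
  -- range (back).
  let D : V ⊕ V → Order.Cofinal P := fun t => match t with
    | Sum.inl v => ⟨{Q | ∃ w, (v, w) ∈ Q.1}, fun Q =>
        let ⟨Q', h1, h2, h3⟩ := hM.exists_mem_fst Q.2 v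
        ⟨⟨Q', h1⟩, h3, h2⟩⟩
    | Sum.inr w => ⟨{Q | ∃ v, (v, w) ∈ Q.1}, fun Q =>
        let ⟨Q', h1, h2, h3⟩ := hM.exists_mem_snd Q.2 w
        ⟨⟨Q', h1⟩, h3, h2⟩⟩
  let s : ℕ → P := Order.sequenceOfCofinals ⟨R, hR⟩ D
  have hs : Monotone s := Order.sequenceOfCofinals.monotone _ D
  have h1 : ∀ v, ∃ w i, (v, w) ∈ (s i).1 := fun v =>
    let ⟨w, hw⟩ := Order.sequenceOfCofinals.encode_mem (⟨R, hR⟩ : P) D (Sum.inl v)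
    ⟨w, _, hw⟩
  have h2 : ∀ w, ∃ v i, (v, w) ∈ (s i).1 := fun w =>
    let ⟨v, hv⟩ := Order.sequenceOfCofinals.encode_mem (⟨R, hR⟩ : P) D (Sum.inr w)
    ⟨v, _, hv⟩
  have hpair : ∀ p q i j, p ∈ (s i).1 → q ∈ (s j).1 →
      (p.1 = q.1 ↔ p.2 = q.2) ∧ (M.Adj p.1 q.1 ↔ M.Adj p.2 q.2) := by
    intro p q i j hp hq
    have hp' := hs (le_max_left i j) hp
    have hq' := hs (le_max_right i j) hq
    exact ⟨(s (max i j)).2.inj _ hp' _ hq', (s (max i j)).2.adj _ hp' _ hq'⟩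
  choose f i hf using h1
  choose g j hg using h2
  refine ⟨⟨⟨f, g, fun v => ?_, fun w => ?_⟩, fun {x y} => ?_⟩, fun p hp => ?_⟩
  · exact (hpair _ _ _ _ (hg (f v)) (hf v)).1.2 rfl
  · exact (hpair _ _ _ _ (hf (g w)) (hg w)).1.1 rfl
  · exact (hpair _ _ _ _ (hf x) (hf y)).2.symm
  · exact (hpair _ _ _ 0 (hf p.1) hp).1.1 rfl

end Homogeneity

/-! ### Stars, strong edges and conjugates. -/

section Star

variable {V : Type u} {α : ℝ} {M : SimpleGraph V}

/-- The star with `n` leaves and centre `none`. -/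
def star (n : ℕ) : SimpleGraph (Option (Fin n)) where
  Adj x y := (x = none ∧ y ≠ none) ∨ (x ≠ none ∧ y = none)
  symm := ⟨fun x y h => by tauto⟩
  loopless := ⟨fun x h => by tauto⟩

theorem preDim_star_of_notMem {n : ℕ} {C : Set (Option (Fin n))} (hC : none ∉ C) :
    preDim α (star n) C = C.ncard := by
  have : (star n).edgesIn C = ∅ := by
    ext e
    induction e with | _ x y
    simp only [mk_mem_edgesIn, star, Set.mem_empty_iff_false, iff_false]
    rintro ⟨⟨rfl, -⟩ | ⟨-, rfl⟩, hx, hy⟩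
    · exact hC hx
    · exact hC hy
  simp [preDim_eq, this]

theorem preDim_star_of_mem {n : ℕ} {C : Set (Option (Fin n))} (hC : none ∈ C) :
    preDim α (star n) C = C.ncard - α * (C.ncard - 1) := by
  have h : (star n).edgesIn C = (fun x => s(none, x)) '' (C \ {none}) := by
    ext e
    induction e with | _ x y
    simp only [mk_mem_edgesIn, star, Set.mem_image, Set.mem_sdiff, Set.mem_singleton_iff,
      Sym2.eq_iff]
    constructor
    · rintro ⟨⟨rfl, h⟩ | ⟨h, rfl⟩, hx, hy⟩
      · exact ⟨y, ⟨hy, h⟩, Or.inl ⟨rfl, rfl⟩⟩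
      · exact ⟨x, ⟨hx, h⟩, Or.inr ⟨rfl, rfl⟩⟩
    · rintro ⟨z, ⟨hz, h⟩, ⟨rfl, rfl⟩ | ⟨rfl, rfl⟩⟩
      · exact ⟨Or.inl ⟨rfl, h⟩, hC, hz⟩
      · exact ⟨Or.inr ⟨h, rfl⟩, hz, hC⟩
  have hinj : Function.Injective fun x : Option (Fin n) => s(none, x) := fun x y hxy =>
    Sym2.congr_right.1 hxy
  have hcard := Set.ncard_sdiff_singleton_add_one hC C.toFinite
  rw [preDim_eq, h, Set.ncard_image_of_injective _ hinj, ← hcard]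
  push_cast
  ring

theorem inClass_star (hα1 : α ≤ 1) (n : ℕ) : InClass α (star n) := by
  refine ⟨inferInstance, fun C => ?_⟩
  by_cases hC : none ∈ C
  · have h1 : 1 ≤ (C.ncard : ℝ) := by
      exact_mod_cast (Set.ncard_pos C.toFinite).2 ⟨_, hC⟩
    rw [preDim_star_of_mem hC]
    nlinarith
  · rw [preDim_star_of_notMem hC]
    positivity

/-- Once the centre is present, each further leaf contributes one vertex and one edge, hence `1 - α
≥ 0`. -/
theorem isStrongIn_star (hα1 : α ≤ 1) {n : ℕ} {A : Set (Option (Fin n))} (hA : none ∈ A) :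
    IsStrongIn α (star n) A Set.univ := by
  refine ⟨Set.subset_univ _, fun C hC _ => ?_⟩
  have h1 : (A.ncard : ℝ) ≤ C.ncard := by exact_mod_cast Set.ncard_le_ncard hC C.toFinite
  rw [preDim_star_of_mem hA, preDim_star_of_mem (hC hA)]
  nlinarith

/-- A single edge is `star 1`. The empty set is strong both in it and in `M`, so the extension axiom
embeds it strongly. -/
theorem IsGeneric.exists_edge (hα1 : α ≤ 1) (hM : M.IsGeneric α) :
    ∃ a b, M.Adj a b ∧ IsStrong α M {a, b} := by
  have h0 : IsStrongIn α (star 1) ∅ Set.univ :=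
    ⟨Set.empty_subset _, fun C _ _ => by
      rw [preDim_empty, sub_zero]; exact (inClass_star hα1 1).2 C⟩
  let f : (star 1).induce (∅ : Set (Option (Fin 1))) ↪g M :=
    ⟨⟨fun x => x.2.elim, fun x => x.2.elim⟩, fun {x} => x.2.elim⟩
  have hempty : IsStrong α M ∅ := by
    rw [isStrong_iff]
    refine ⟨Set.finite_empty, fun C hC _ => ?_⟩
    have := (hM.age_subset _ hC).2 Set.univ
    rwa [← preDim_image (isEmbOn_val M _ _), Set.image_univ, Subtype.range_coe,
      ← preDim_empty α M] at this
  obtain ⟨Λ, -, hΛ⟩ := hM.extension _ _ (inClass_star hα1 1) ∅ h0 f (by rwa [Set.range_eq_empty])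
  refine ⟨Λ none, Λ (some 0), Λ.map_adj_iff.2 (Or.inl ⟨rfl, by simp⟩), ?_⟩
  have : Set.range Λ = {Λ none, Λ (some 0)} := by
    ext v
    simp only [Set.mem_range, Option.exists, Fin.exists_fin_one, Set.mem_insert_iff,
      Set.mem_singleton_iff, eq_comm]
  rwa [← this]

theorem isStrong_left (hα0 : 0 ≤ α) (hα1 : α ≤ 1) {a b : V} (hab : M.Adj a b)
    (h : IsStrong α M {a, b}) : IsStrong α M {a} := by
  refine IsStrongIn.trans_isStrong hα0 ⟨by simp, fun C h1 h2 => ?_⟩ h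
  rw [preDim_singleton]
  by_cases hb : b ∈ C
  · have hC : C = {a, b} := h2.antisymm (Set.insert_subset (h1 rfl) (by simpa using hb))
    have hE : M.edgesIn {a, b} ⊆ {s(a, b)} := by
      intro e
      induction e with | _ x y
      simp only [mk_mem_edgesIn, Set.mem_insert_iff, Set.mem_singleton_iff, Sym2.eq_iff]
      rintro ⟨hxy, rfl | rfl, rfl | rfl⟩
      · exact absurd hxy (M.loopless.irrefl _)
      · simp
      · simp
      · exact absurd hxy (M.loopless.irrefl _)
    have h3 : ((M.edgesIn {a, b}).ncard : ℝ) ≤ 1 := by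
      have := Set.ncard_le_ncard hE (Set.finite_singleton _)
      rw [Set.ncard_singleton] at this
      exact_mod_cast this
    rw [hC, preDim_eq, Set.ncard_pair hab.ne]
    push_cast
    nlinarith
  · have hC : C = {a} := by
      refine Set.Subset.antisymm (fun x hx => ?_) h1
      rcases h2 hx with rfl | rfl
      · rfl
      · exact absurd hx hb
    rw [hC, preDim_singleton, sub_self]

/-- In a strong edge `ab`, the end `b` has arbitrarily many conjugates over `a`. -/
theorem IsGeneric.exists_conjugates (hα0 : 0 ≤ α) (hα1 : α ≤ 1) (hM : M.IsGeneric α) {a b : V}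
    (hab : M.Adj a b) (h : IsStrong α M {a, b}) (n : ℕ) :
    ∃ g : Fin n → (M ≃g M), (∀ i, g i a = a) ∧ Function.Injective fun i => g i b := by
  have hf : IsEmbOn (star n) M (fun _ => a) {none} := by
    refine ⟨Set.injOn_singleton _ _, ?_⟩
    rintro _ rfl _ rfl
    simp
  -- A star with `n` leaves is placed strongly in `M` with centre `a`. Each edge of it is strong, so
  -- homogeneity carries `b` to each leaf while fixing `a`.
  obtain ⟨Λ, hΛ, hΛs⟩ := hM.extension _ _ (inClass_star hα1 n) {none}
    (isStrongIn_star hα1 rfl) hf.toEmbedding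
    (by rw [hf.range_toEmbedding, Set.image_singleton]; exact isStrong_left hα0 hα1 hab h)
  have hΛa : Λ none = a := hΛ ⟨none, rfl⟩
  have key : ∀ i : Fin n, ∃ g : M ≃g M, g a = a ∧ g b = Λ (some i) := by
    intro i
    have hadj : M.Adj a (Λ (some i)) := by
      rw [← hΛa]
      exact Λ.map_adj_iff.2 (Or.inl ⟨rfl, by simp⟩)
    have hst : IsStrong α M {a, Λ (some i)} := by
      have h1 := (isStrongIn_star (α := α) hα1 (A := {none, some i}) (by simp)).image
        (Λ.isEmbOn Set.univ)
      rw [Set.image_univ, Set.image_pair, hΛa] at h1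
      exact h1.trans_isStrong hα0 hΛs
    obtain ⟨g, hg⟩ := hM.exists_aut (R := {(a, a), (b, Λ (some i))}) <| by
      refine ⟨?_, ?_, ?_, ?_⟩
      · rintro _ (rfl | rfl) _ (rfl | rfl)
        · simp
        · simp [hab.ne, hadj.ne]
        · simp [hab.ne', hadj.ne']
        · simp
      · rintro _ (rfl | rfl) _ (rfl | rfl)
        · simp
        · simp [hab, hadj]
        · simp [hab.symm, hadj.symm]
        · simp
      · rwa [Set.image_pair]
      · rwa [Set.image_pair]
    exact ⟨g, hg _ (Or.inl rfl), hg _ (Or.inr rfl)⟩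
  choose g hg1 hg2 using key
  refine ⟨g, hg1, fun i j hij => ?_⟩
  simp only [hg2] at hij
  simpa using hij

end Star

/-! ### The flow of orientations and its lack of invariant measures. -/

section Flow

variable {V : Type u} {α : ℝ} {M : SimpleGraph V} {k : ℕ}

/-- The compatible choices of at least one direction for every edge, with out-degrees at
most `k`. -/
def orientations (M : SimpleGraph V) (k : ℕ) : Set (V × V → Bool) :=
  {x | (∀ u v, M.Adj u v → x (u, v) = true ∨ x (v, u) = true) ∧
    ∀ (u : V) (S : Finset V), (∀ v ∈ S, x (u, v) = true) → S.card ≤ k}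

/-- The space of orientations with out-degrees at most `k`. -/
def Orientation (M : SimpleGraph V) (k : ℕ) : Type u := orientations M k

instance : TopologicalSpace (Orientation M k) :=
  inferInstanceAs (TopologicalSpace (orientations M k))

instance : T2Space (Orientation M k) := inferInstanceAs (T2Space (orientations M k))

theorem isOpen_setOf_apply_eq {ι : Type*} (i : ι) (b : Bool) : IsOpen {x : ι → Bool | x i = b} :=
  (isOpen_discrete ({b} : Set Bool)).preimage
    (show Continuous fun x : ι → Bool => x i from continuous_apply i)

theorem isClosed_setOf_apply_eq {ι : Type*} (i : ι) (b : Bool) :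
    IsClosed {x : ι → Bool | x i = b} :=
  (isClosed_discrete ({b} : Set Bool)).preimage
    (show Continuous fun x : ι → Bool => x i from continuous_apply i)

/-- Each condition involves finitely many coordinates; this is why the out-degree bound is phrased
through finite sets `S`. -/
theorem isClosed_orientations (M : SimpleGraph V) (k : ℕ) : IsClosed (orientations M k) := by
  simp only [orientations, Set.ofPred_and, Set.ofPred_forall]
  refine (isClosed_iInter fun u => isClosed_iInter fun v => isClosed_iInter fun _ => ?_).inter
    (isClosed_iInter fun u => isClosed_iInter fun S => ?_)
  · exact (isClosed_setOf_apply_eq (u, v) true).union (isClosed_setOf_apply_eq (v, u) true)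
  · refine isClosed_imp ?_ isClosed_const
    simp only [Set.ofPred_forall]
    exact S.finite_toSet.isOpen_biInter fun v _ => isOpen_setOf_apply_eq (u, v) true

instance : CompactSpace (Orientation M k) :=
  isCompact_iff_compactSpace.1 (isClosed_orientations M k).isCompact

instance : MulAction (M ≃g M) (Orientation M k) where
  smul g x := ⟨fun p => x.1 (g⁻¹ p.1, g⁻¹ p.2), fun u v h => x.2.1 _ _ (g⁻¹.map_adj_iff.2 h),
    fun u S hS => by
      rw [← S.card_map (g⁻¹ : M ≃g M).toEquiv.toEmbedding]
      refine x.2.2 (g⁻¹ u) _ fun v hv => ?_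
      obtain ⟨w, hw, rfl⟩ := Finset.mem_map.1 hv
      exact hS w hw⟩
  one_smul x := rfl
  mul_smul g h x := Subtype.ext <| funext fun p => by
    change x.1 ((g * h)⁻¹ p.1, (g * h)⁻¹ p.2) = x.1 (h⁻¹ (g⁻¹ p.1), h⁻¹ (g⁻¹ p.2))
    rw [mul_inv_rev]
    rfl

theorem orientation_smul_apply (g : M ≃g M) (x : Orientation M k) (u v : V) :
    (g • x).1 (u, v) = x.1 (g⁻¹ u, g⁻¹ v) := rfl

theorem isOpen_orientation (M : SimpleGraph V) (k : ℕ) (u v : V) (b : Bool) :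
    IsOpen {x : Orientation M k | x.1 (u, v) = b} :=
  (isOpen_setOf_apply_eq (u, v) b).preimage continuous_subtype_val

instance : ContinuousSMul (M ≃g M) (Orientation M k) where
  continuous_smul := by
    refine Continuous.subtype_mk (continuous_pi fun p => continuous_discrete_rng.2 fun b => ?_) _
    -- Split according to the preimages `u`, `v` of the two ends of `p` under the automorphism.
    have : (fun q : (M ≃g M) × Orientation M k => q.2.1 (q.1⁻¹ p.1, q.1⁻¹ p.2)) ⁻¹' {b} =
        ⋃ u, ⋃ v, ({g : M ≃g M | g u = p.1} ∩ {g : M ≃g M | g v = p.2}) ×ˢ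
          {x : Orientation M k | x.1 (u, v) = b} := by
      ext ⟨g, x⟩
      simp only [Set.mem_preimage, Set.mem_singleton_iff, Set.mem_iUnion, Set.mem_prod,
        Set.mem_inter_iff, Set.mem_ofPred_eq]
      constructor
      · exact fun h => ⟨_, _, ⟨RelIso.apply_inv_self g _, RelIso.apply_inv_self g _⟩, h⟩
      · rintro ⟨u, v, ⟨hu, hv⟩, h⟩
        rwa [← hu, ← hv, RelIso.inv_apply_self, RelIso.inv_apply_self]
    rw [this]
    exact isOpen_iUnion fun u => isOpen_iUnion fun v =>
      ((isOpen_aut_eval M u _).inter (isOpen_aut_eval M v _)).prod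
        (isOpen_orientation M k u v b)

/-- A graph all of whose finite subgraphs have nonnegative pre-dimension has an orientation with
bounded out-degrees. -/
theorem nonempty_orientation (hα : 0 < α) (hM : ∀ A : Set V, A.Finite → 0 ≤ preDim α M A)
    (hk : 1 ≤ α * k) : Nonempty (Orientation M k) := by
  classical
  -- Every vertex offers `k` slots, and an edge may take any slot at either end. An injective choice
  -- orients each edge away from the vertex whose slot it takes.
  let t : M.edgeSet → Finset (V × Fin k) := fun e => e.1.toFinset ×ˢ Finset.univ
  obtain ⟨f, hf, hft⟩ := (Finset.all_card_le_biUnion_card_iff_exists_injective t).1 <| by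
    intro s
    let U : Finset V := s.biUnion fun e => e.1.toFinset
    have h1 : s.biUnion t = U ×ˢ Finset.univ := by
      ext p
      simp [t, U]
    have h2 : s.card ≤ (M.edgesIn U).ncard := by
      rw [← Finset.card_map (Function.Embedding.subtype _), ← Set.ncard_coe_finset]
      refine Set.ncard_le_ncard (fun e he => ?_) (M.edgesIn_finite U.finite_toSet)
      obtain ⟨e, he', rfl⟩ := Finset.mem_map.1 (Finset.mem_coe.1 he)
      exact ⟨e.2, fun v hv => Finset.mem_biUnion.2 ⟨e, he', Sym2.mem_toFinset.2 hv⟩⟩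
    have h3 := hM U U.finite_toSet
    rw [preDim_eq, Set.ncard_coe_finset] at h3
    -- Hall's condition: `α|s| ≤ α|E(U)| ≤ |U| ≤ |U|·αk`.
    have h4 : α * s.card ≤ α * (U.card * k) := by
      have h5 : (s.card : ℝ) ≤ (M.edgesIn U).ncard := by exact_mod_cast h2
      have h6 : (0 : ℝ) ≤ U.card := by positivity
      nlinarith
    rw [h1, Finset.card_product, Finset.card_univ, Fintype.card_fin]
    exact_mod_cast le_of_mul_le_mul_left h4 hα
  have hfe : ∀ u v (h : M.Adj u v), (f ⟨s(u, v), h⟩).1 = u ∨ (f ⟨s(u, v), h⟩).1 = v := by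
    intro u v h
    have := (Finset.mem_product.1 (hft ⟨s(u, v), h⟩)).1
    simpa using this
  refine ⟨⟨fun p => decide (∃ h : M.Adj p.1 p.2, (f ⟨s(p.1, p.2), h⟩).1 = p.1),
    fun u v h => ?_, fun u S hS => ?_⟩⟩
  · simp only [decide_eq_true_eq]
    refine (hfe u v h).imp (fun h' => ⟨h, h'⟩) fun h' => ⟨h.symm, ?_⟩
    have : (⟨s(v, u), h.symm⟩ : M.edgeSet) = ⟨s(u, v), h⟩ := Subtype.ext Sym2.eq_swap
    rw [this, h']
  · simp only [decide_eq_true_eq] at hS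
    choose hadj hfu using hS
    have hinj : Function.Injective fun v : S => (f ⟨s(u, v), hadj v v.2⟩).2 := by
      intro v w hvw
      have h1 := hf (Prod.ext ((hfu v v.2).trans (hfu w w.2).symm) hvw)
      exact Subtype.ext (Sym2.congr_right.1 (congrArg Subtype.val h1))
    simpa using Fintype.card_le_of_injective _ hinj

/-- If `b` has arbitrarily many conjugates over `a`, an invariant random orientation of bounded
out-degree directs no edge from `a` to `b`. -/
theorem measure_orientation_eq_zero [MeasurableSpace (Orientation M k)]
    [BorelSpace (Orientation M k)] (μ : Measure (Orientation M k)) [IsProbabilityMeasure μ]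
    (hμ : ∀ g : M ≃g M, μ.map (fun x => g • x) = μ) {a b : V}
    (hab : ∀ n, ∃ g : Fin n → (M ≃g M), (∀ i, g i a = a) ∧ Function.Injective fun i => g i b) :
    μ {x | x.1 (a, b) = true} = 0 := by
  classical
  have hmeas : ∀ u v, MeasurableSet {x : Orientation M k | x.1 (u, v) = true} := fun u v =>
    (isOpen_orientation M k u v true).measurableSet
  have hinv : ∀ (g : M ≃g M) (u v : V),
      μ {x | x.1 (g u, g v) = true} = μ {x | x.1 (u, v) = true} := by
    intro g u v
    conv_lhs => rw [← hμ g, Measure.map_apply (continuous_const_smul g).measurable (hmeas _ _)]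
    congr 1
    ext x
    simp [orientation_smul_apply]
  by_contra hne
  -- With this many conjugates of `b`, the expected number of those that `a` points to would exceed
  -- `k`.
  obtain ⟨n, hn⟩ := ENNReal.exists_nat_mul_gt hne (ENNReal.natCast_ne_top k)
  obtain ⟨g, hga, hg⟩ := hab n
  refine hn.not_ge ?_
  calc (n : ENNReal) * μ {x | x.1 (a, b) = true}
      = ∑ i : Fin n, μ {x | x.1 (a, g i b) = true} := by
        have : ∀ i, μ {x | x.1 (a, g i b) = true} = μ {x | x.1 (a, b) = true} := fun i => by
          rw [← hinv (g i) a b, hga]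
        simp [this]
    _ = ∑ i : Fin n, ∫⁻ x, {x : Orientation M k | x.1 (a, g i b) = true}.indicator 1 x ∂μ := by
        simp only [lintegral_indicator_one (hmeas _ _)]
    _ = ∫⁻ x, ∑ i : Fin n, {x : Orientation M k | x.1 (a, g i b) = true}.indicator 1 x ∂μ :=
        (lintegral_finsetSum _ fun i _ => measurable_one.indicator (hmeas _ _)).symm
    _ ≤ ∫⁻ _, (k : ENNReal) ∂μ := by
        refine lintegral_mono fun x => ?_
        simp only [Set.indicator_apply, Set.mem_ofPred_eq, Pi.one_apply, Finset.sum_boole]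
        -- The conjugates `g i b` are distinct, so the sum counts a set of out-neighbours of `a`.
        rw [← Finset.card_map ⟨_, hg⟩]
        refine Nat.cast_le.2 (x.2.2 a _ fun v hv => ?_)
        obtain ⟨i, hi, rfl⟩ := Finset.mem_map.1 hv
        exact (Finset.mem_filter.1 hi).2
    _ = k := by simp

theorem IsGeneric.not_isAmenableGroup (hα0 : 0 < α) (hα1 : α ≤ 1) (hM : M.IsGeneric α) :
    ¬ IsAmenableGroup (M ≃g M) := by
  intro h
  obtain ⟨k, hk⟩ := exists_nat_ge (1 / α)
  rw [div_le_iff₀' hα0] at hk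
  have : Nonempty (Orientation M k) := nonempty_orientation hα0 (fun A hA => by
    have := (hM.age_subset A hA).2 Set.univ
    rwa [← preDim_image (isEmbOn_val M _ _), Set.image_univ, Subtype.range_coe] at this) hk
  let : MeasurableSpace (Orientation M k) := borel _
  have : BorelSpace (Orientation M k) := ⟨rfl⟩
  obtain ⟨μ, hμ1, hμ⟩ := h (Orientation M k)
  obtain ⟨a, b, hab, hs⟩ := hM.exists_edge hα1
  have h1 := measure_orientation_eq_zero μ hμ (hM.exists_conjugates hα0.le hα1 hab hs)
  have h2 := measure_orientation_eq_zero μ hμ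
    (hM.exists_conjugates hα0.le hα1 hab.symm (Set.pair_comm a b ▸ hs))
  have h3 : (Set.univ : Set (Orientation M k)) =
      {x | x.1 (a, b) = true} ∪ {x | x.1 (b, a) = true} :=
    (Set.eq_univ_of_forall fun x => x.2.1 a b hab).symm
  have h4 : μ Set.univ = 0 := by
    rw [h3]
    exact measure_union_null h1 h2
  rw [measure_univ] at h4
  exact one_ne_zero h4

end Flow

end SimpleGraph

theorem mainTheorem1 (α : ℝ) (hα0 : 0 < α) (hα1 : α < 1) (hα : Irrational α) :
    (∃ M : SimpleGraph ℕ, M.IsGeneric α) ∧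
      ∀ (V : Type u) (M : SimpleGraph V), M.IsGeneric α → ¬ IsAmenableGroup (M ≃g M) :=
  ⟨SimpleGraph.exists_isGeneric hα0.le, fun _ _ hM => hM.not_isAmenableGroup hα0 hα1.le⟩
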